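/- Let $\Sigma$ be a finite alphabet with at least two elements, and equip $\Sigma^\omega$ with the $\sigma$-algebra generated by the cylinder sets and the uniform probability measure $\mathrm{Pr}$, i.e. $\mathrm{Pr}(a_1\cdots a_n\Sigma^\omega)=|\Sigma|^{-n}$ for all $a_1,\dots,a_n\in\Sigma$. Let $\mathcal{U}=(Q,\Sigma,\delta,Q_0,F)$ be a nondeterministic Büchi automaton with finite state set $Q$, transition function $\delta:Q\times\Sigma\to 2^Q$ (extended as usual to $2^Q\times\Sigma^*$, with $\delta(q,z)=\delta(\{q\},z)$), nonempty set $Q_0\subseteq Q$ of initial states and nonempty set $F\subseteq Q$ of accepting states. A run for an infinite word $a_1a_2\cdots$ is a sequence $q_0q_1\cdots$ with $q_0\in Q_0$ and $q_{i+1}\in\delta(q_i,a_{i+1})$ for all $i$; it is accepting if $q_i\in F$ for infinitely many $i$. For $R\subseteq Q$, let $\mathcal{L}_\omega(R)$ be the set of infinite words that have an accepting run in $\mathcal{U}$ with $R$ in place of $Q_0$, and write $\mathcal{L}_\omega(q)=\mathcal{L}_\omega(\{q\})$. Suppose that $\mathcal{U}$ is unambiguous (every infinite word has at most one accepting run) and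 strongly connected (for all $p,q\in Q$ there is $x\in\Sigma^*$ with $q\in\delta(p,x)$). A set $C\subseteq Q$ is a cut if $\mathcal{L}_\omega(p)\cap\mathcal{L}_\omega(q)=\varnothing$ for all $p,q\in C$ with $p\neq q$, and $\mathrm{Pr}(\mathcal{L}_\omega(C))=1$. A cut is pure if it has the form $\delta(q,z)$ for some $q\in Q$ and $z\in\Sigma^*$. Then for all $q\in Q$ and $z\in\Sigma^*$: $\delta(q,z)$ is a cut if and only if $\delta(q,zy)\neq\varnothing$ for every word $y\in\Sigma^*$. Furthermore, if $\mathcal{U}$ is positive, i.e. $\mathrm{Pr}(\mathcal{L}_\omega(Q_0))>0$, then for each cut $C$ the following are equivalent: 1. $C$ is pure; 2. for each state $q\in Q$ there is a word $z\in\Sigma^*$ with $C=\delta(q,z)$; 3. for each cut $C'$ there is a word $y\in\Sigma^*$ with $C=\delta(C',y)$. -/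

import Mathlib

open MeasureTheory

/-- A nondeterministic Büchi automaton `(Q, A, δ, Q₀, F)` has the same data as an `NFA`:
`step` is `δ`, `start` is `Q₀`, `accept` is `F`, and `evalFrom R x` is `δ(R, x)`.
Only the acceptance condition (on infinite words) differs. -/
abbrev NBA (A : Type*) (Q : Type*) := NFA A Q

namespace NBA

variable {A Q : Type*}

/-- The automaton `U[R]`: `U` with `R` as its set of initial states. -/
def withStart (U : NBA A Q) (R : Set Q) : NBA A Q where
  step := U.step
  start := R
  accept := U.accept

/-- `ρ` is a run of `U` for the infinite word `w`; `w i` is the `(i+1)`-st letter. -/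
def IsRun (U : NBA A Q) (w : ℕ → A) (ρ : ℕ → Q) : Prop :=
  ρ 0 ∈ U.start ∧ ∀ i, ρ (i + 1) ∈ U.step (ρ i) (w i)

/-- A run is accepting if it visits `F` infinitely often. -/
def IsAcceptingRun (U : NBA A Q) (w : ℕ → A) (ρ : ℕ → Q) : Prop :=
  U.IsRun w ρ ∧ {i | ρ i ∈ U.accept}.Infinite

/-- The language of infinite words that have an accepting run. -/
def language (U : NBA A Q) : Set (ℕ → A) :=
  {w | ∃ ρ, U.IsAcceptingRun w ρ}

/-- Every infinite word has at most one accepting run. -/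
def IsUnambiguous (U : NBA A Q) : Prop :=
  ∀ w ρ ρ', U.IsAcceptingRun w ρ → U.IsAcceptingRun w ρ' → ρ = ρ'

/-- Every state is reachable from every state. -/
def IsStronglyConnected (U : NBA A Q) : Prop :=
  ∀ p q : Q, ∃ x : List A, q ∈ U.evalFrom {p} x

end NBA

/-- The uniform probability measure on infinite words: all letters are independent and
uniformly distributed, so the cylinder of a word of length `n` has measure `1 / |A| ^ n`. -/
noncomputable def uniformWordMeasure (A : Type*) [Fintype A] [Nonempty A] [MeasurableSpace A] :
    Measure (ℕ → A) :=
  Measure.infinitePi fun _ : ℕ => (PMF.uniformOfFintype A).toMeasure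

namespace NBA

variable {A Q : Type*} [Fintype A] [Nonempty A] [MeasurableSpace A]

/-- `Pr(L(U)) > 0`. -/
def IsPositive (U : NBA A Q) : Prop :=
  0 < uniformWordMeasure A U.language

/-- `Pr(L(U)) = 1`. -/
def IsAlmostUniversal (U : NBA A Q) : Prop :=
  uniformWordMeasure A U.language = 1

/-- The states of `C` have pairwise disjoint languages and `U[C]` is almost universal. -/
def IsCut (U : NBA A Q) (C : Set Q) : Prop :=
  (∀ p ∈ C, ∀ q ∈ C, p ≠ q →
    (U.withStart {q}).language ∩ (U.withStart {p}).language = ∅) ∧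
  (U.withStart C).IsAlmostUniversal

/-- A cut of the form `δ(q, z)`. -/
def IsPureCut (U : NBA A Q) (C : Set Q) : Prop :=
  U.IsCut C ∧ ∃ (q : Q) (z : List A), C = U.evalFrom {q} z

end NBA

/-! Two states of one set δ(p, x) have disjoint languages: otherwise two different accepting runs of
one word would arise from a start state through p (`disjoint_language_of_mem_evalFrom`). So the
first equivalence concerns measure only. If δ(q, zy) is empty, the cylinder of y is rejected from
δ(q, z), and it has positive measure.

Conversely, let R survive every word. By König's lemma every word has a run from R, so a rejected
word has a suffix with a run that avoids F. Such words are null: the probabilities v of avoiding F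
satisfy v ≤ M'v, where M is the transition matrix divided by |Σ| and M' is M with the columns of F
deleted. Unambiguity bounds the entries of the powers of M by 1 and strong connectivity makes M
irreducible, so v = 0 by `Matrix.eq_zero_of_le_mulVec`.

If U is positive, every state has a language of positive measure, so cuts are maximal among sets of
states with pairwise disjoint languages (`IsCut.mem_of_disjoint`), and every state leads to some cut
(`exists_forall_evalFrom_ne_empty`). The remaining equivalences follow. Languages are never shown to
be measurable; outer-measure estimates suffice. -/

/-! ### Prepending finite words to infinite words -/

/-- The infinite word `a w`. -/
def consWord {A : Type*} (a : A) (w : ℕ → A) : ℕ → A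
  | 0 => a
  | n + 1 => w n

/-- The infinite word `x w` for a finite word `x`. -/
def appendWord {A : Type*} (x : List A) (w : ℕ → A) : ℕ → A :=
  x.foldr consWord w

@[simp] lemma consWord_zero {A : Type*} (a : A) (w : ℕ → A) : consWord a w 0 = a := rfl

@[simp] lemma consWord_succ {A : Type*} (a : A) (w : ℕ → A) (n : ℕ) :
    consWord a w (n + 1) = w n := rfl

@[simp] lemma consWord_head_tail {A : Type*} (w : ℕ → A) :
    consWord (w 0) (fun n => w (n + 1)) = w := by
  funext n; cases n <;> rfl

@[simp] lemma appendWord_cons {A : Type*} (a : A) (x : List A) (w : ℕ → A) :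
    appendWord (a :: x) w = consWord a (appendWord x w) := rfl

/-- Splitting an infinite word into its first letter and its tail. -/
def consWordEquiv (A : Type*) [MeasurableSpace A] : A × (ℕ → A) ≃ᵐ (ℕ → A) where
  toFun p := consWord p.1 p.2
  invFun w := (w 0, fun n => w (n + 1))
  left_inv p := rfl
  right_inv w := consWord_head_tail w
  measurable_toFun := by
    refine measurable_pi_lambda _ fun n => ?_
    cases n with
    | zero => exact measurable_fst
    | succ n => exact (measurable_pi_apply n).comp measurable_snd
  measurable_invFun := by
    exact (measurable_pi_apply 0).prodMk
      (measurable_pi_lambda _ fun n => measurable_pi_apply (n + 1))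

@[simp] lemma consWordEquiv_apply {A : Type*} [MeasurableSpace A] (p : A × (ℕ → A)) :
    consWordEquiv A p = consWord p.1 p.2 := rfl

/-! ### The uniform measure under prepending and dropping letters -/

section Measure

variable {A : Type*} [Fintype A] [Nonempty A] [MeasurableSpace A]

instance : IsProbabilityMeasure (uniformWordMeasure A) := by
  unfold uniformWordMeasure; infer_instance

lemma measurePreserving_consWord :
    MeasurePreserving (consWordEquiv A)
      ((PMF.uniformOfFintype A).toMeasure.prod (uniformWordMeasure A)) (uniformWordMeasure A) := by
  classical
  refine ⟨(consWordEquiv A).measurable, ?_⟩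
  refine Measure.eq_infinitePi _ fun s t ht => ?_
  obtain ⟨N, hN⟩ := s.exists_nat_subset_range
  set m := (PMF.uniformOfFintype A).toMeasure
  -- Padding with `Set.univ` turns a box over `s` into a box over an initial segment, whose
  -- coordinate 0 splits off.
  let t' : ℕ → Set A := fun i => if i ∈ s then t i else Set.univ
  have ht' : ∀ i, MeasurableSet (t' i) := fun i => by
    by_cases h : i ∈ s <;> simp [t', h, ht]
  have hpre : consWordEquiv A ⁻¹' (Set.pi s t) =
      t' 0 ×ˢ Set.pi (Finset.range N : Set ℕ) (fun i => t' (i + 1)) := by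
    ext ⟨a, w⟩
    simp only [Set.mem_preimage, Set.mem_pi, Set.mem_prod, Finset.mem_coe]
    constructor
    · intro h
      refine ⟨?_, fun i _ => ?_⟩
      · by_cases h0 : 0 ∈ s
        · simpa [t', h0] using h 0 h0
        · simp [t', h0]
      · by_cases h0 : i + 1 ∈ s
        · simpa [t', h0] using h (i + 1) h0
        · simp [t', h0]
    · rintro ⟨h0, h1⟩ i hi
      cases i with
      | zero => simp only [t', if_pos hi] at h0; exact h0
      | succ i =>
        have h2 := h1 i (by have := Finset.mem_range.1 (hN hi); simp; omega)
        simp only [t', if_pos hi] at h2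
        exact h2
  have hprod : ∏ i ∈ s, m (t i) = ∏ i ∈ Finset.range (N + 1), m (t' i) := by
    have h1 : ∏ i ∈ s, m (t i) = ∏ i ∈ s, m (t' i) :=
      Finset.prod_congr rfl fun i hi => by simp [t', hi]
    rw [h1]
    refine Finset.prod_subset (hN.trans (Finset.range_mono (Nat.le_succ N))) fun i _ hi => ?_
    simp [t', hi]
  rw [(consWordEquiv A).map_apply, hpre, Measure.prod_prod, hprod, Finset.prod_range_succ',
    mul_comm, uniformWordMeasure, Measure.infinitePi_pi _ fun i _ => ht' _]

lemma measurePreserving_tail :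
    MeasurePreserving (fun w : ℕ → A => fun n => w (n + 1))
      (uniformWordMeasure A) (uniformWordMeasure A) :=
  measurePreserving_snd.comp (measurePreserving_consWord (A := A)).symm

lemma measurePreserving_drop (m : ℕ) :
    MeasurePreserving (fun w : ℕ → A => fun n => w (n + m))
      (uniformWordMeasure A) (uniformWordMeasure A) := by
  induction m with
  | zero => exact MeasurePreserving.id _
  | succ m ih =>
    have := measurePreserving_tail.comp ih
    simpa [Function.comp_def, add_right_comm, add_assoc, add_comm 1] using this

/-- This holds for all sets of words, measurable or not. -/
lemma uniformWordMeasure_image_consWord [DiscreteMeasurableSpace A] (a : A) (S : Set (ℕ → A)) :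
    uniformWordMeasure A (consWord a '' S) =
      (Fintype.card A : ENNReal)⁻¹ * uniformWordMeasure A S := by
  have himg : consWord a '' S = consWordEquiv A '' ({a} ×ˢ S) := by
    ext w; simp only [Set.mem_image, Prod.exists, Set.mem_prod, Set.mem_singleton_iff,
      consWordEquiv_apply]; aesop
  rw [himg, (consWordEquiv A).image_eq_preimage_symm,
    (measurePreserving_consWord (A := A)).symm.measure_preimage_equiv, Measure.prod_prod,
    PMF.toMeasure_apply_singleton _ _ (measurableSet_singleton a), PMF.uniformOfFintype_apply]

end Measure

/-! ### Irreducible nonnegative matrices -/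

section Matrix

open Matrix Finset Filter Topology

variable {Q : Type*} [Fintype Q]

lemma Matrix.mulVec_mono_of_nonneg {M : Matrix Q Q ℝ} (hM : ∀ p q, 0 ≤ M p q) {v w : Q → ℝ}
    (h : v ≤ w) : M *ᵥ v ≤ M *ᵥ w := fun p =>
  Finset.sum_le_sum fun q _ => mul_le_mul_of_nonneg_left (h q) (hM p q)

variable [DecidableEq Q]

lemma Matrix.pow_entry_nonneg {M : Matrix Q Q ℝ} (hM : ∀ p q, 0 ≤ M p q) (n : ℕ) (p q : Q) :
    0 ≤ (M ^ n) p q := by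
  induction n generalizing q with
  | zero => rw [pow_zero, Matrix.one_apply]; split_ifs <;> norm_num
  | succ n ih =>
    rw [pow_succ, Matrix.mul_apply]
    exact Finset.sum_nonneg fun r _ => mul_nonneg (ih r) (hM r q)

/-- An irreducible nonnegative matrix with bounded powers strictly dominates no matrix that has a
nonzero nonnegative subinvariant vector. -/
lemma Matrix.eq_zero_of_le_mulVec {M M' : Matrix Q Q ℝ} {K : ℝ} (hM : ∀ p q, 0 ≤ M p q)
    (hbdd : ∀ n p q, (M ^ n) p q ≤ K) (hirr : ∀ p q, ∃ k, 0 < (M ^ k) p q)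
    (hle : ∀ p q, M' p q ≤ M p q) {p₀ q₀ : Q} (hlt : M' p₀ q₀ < M p₀ q₀)
    {v : Q → ℝ} (hv : 0 ≤ v) (hsub : v ≤ M' *ᵥ v) : v = 0 := by
  have hpow := Matrix.pow_entry_nonneg hM
  have hMv : v ≤ M *ᵥ v := hsub.trans fun p =>
    Finset.sum_le_sum fun q _ => mul_le_mul_of_nonneg_right (hle p q) (hv q)
  have hge : ∀ n, v ≤ (M ^ n) *ᵥ v := by
    intro n
    induction n with
    | zero => simp
    | succ n ih =>
      rw [pow_succ, ← Matrix.mulVec_mulVec]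
      exact ih.trans (Matrix.mulVec_mono_of_nonneg (hpow n) hMv)
  -- If v is fixed by M and nonzero, irreducibility makes `v q₀` positive, so the strict entry at
  -- `(p₀, q₀)` contradicts `hsub`.
  by_cases hd : M *ᵥ v = v
  · by_contra hne
    obtain ⟨r, hr⟩ := Function.ne_iff.1 hne
    have hr' : 0 < v r := lt_of_le_of_ne (hv r) (Ne.symm hr)
    have hfix : ∀ n, (M ^ n) *ᵥ v = v := by
      intro n
      induction n with
      | zero => simp
      | succ n ih => rw [pow_succ, ← Matrix.mulVec_mulVec, hd, ih]
    obtain ⟨k, hk⟩ := hirr q₀ r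
    have hq₀ : 0 < v q₀ := by
      rw [← hfix k]
      exact Finset.sum_pos' (fun q _ => mul_nonneg (hpow k q₀ q) (hv q))
        ⟨r, Finset.mem_univ r, mul_pos hk hr'⟩
    have h1 : (M' *ᵥ v) p₀ < (M *ᵥ v) p₀ :=
      Finset.sum_lt_sum (fun q _ => mul_le_mul_of_nonneg_right (hle p₀ q) (hv q))
        ⟨q₀, Finset.mem_univ q₀, mul_lt_mul_of_pos_right hlt hq₀⟩
    rw [hd] at h1
    exact absurd (hsub p₀) (not_le.2 h1)
  -- Otherwise the defect Mv − v is positive at some q. Its images under the powers of M telescope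
  -- to a bounded sum, so column q of the powers tends to 0; irreducibility extends this to all
  -- columns, and v is at most the limit of `(M ^ k) *ᵥ v`.
  · obtain ⟨q, hq⟩ := Function.ne_iff.1 hd
    have hdq : 0 < (M *ᵥ v - v) q := by
      have := lt_of_le_of_ne (hMv q) (Ne.symm hq)
      simpa using this
    have hdnn : 0 ≤ M *ᵥ v - v := sub_nonneg.2 hMv
    have htel : ∀ n, ∑ k ∈ range n, (M ^ k) *ᵥ (M *ᵥ v - v) = (M ^ n) *ᵥ v - v := by
      intro n
      induction n with
      | zero => simp
      | succ n ih =>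
        rw [sum_range_succ, ih, Matrix.mulVec_sub, Matrix.mulVec_mulVec, ← pow_succ]
        abel
    have hzero : ∀ p, Tendsto (fun k => (M ^ k) p q) atTop (𝓝 0) := by
      intro p
      have hsum : Summable fun k => (M ^ k) p q * (M *ᵥ v - v) q := by
        refine summable_of_sum_range_le (c := ∑ r, K * v r)
          (fun k => mul_nonneg (hpow k p q) hdq.le) fun n => ?_
        calc ∑ k ∈ range n, (M ^ k) p q * (M *ᵥ v - v) q
            ≤ ∑ k ∈ range n, ((M ^ k) *ᵥ (M *ᵥ v - v)) p :=
              Finset.sum_le_sum fun k _ => Finset.single_le_sum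
                (f := fun r => (M ^ k) p r * (M *ᵥ v - v) r)
                (fun r _ => mul_nonneg (hpow k p r) (hdnn r)) (Finset.mem_univ q)
          _ = ((M ^ n) *ᵥ v) p - v p := by
              rw [← Finset.sum_apply, htel n, Pi.sub_apply]
          _ ≤ ((M ^ n) *ᵥ v) p := sub_le_self _ (hv p)
          _ ≤ ∑ r, K * v r := Finset.sum_le_sum fun r _ =>
              mul_le_mul_of_nonneg_right (hbdd n p r) (hv r)
      have := hsum.tendsto_atTop_zero.mul_const ((M *ᵥ v - v) q)⁻¹
      simpa only [mul_assoc, mul_inv_cancel₀ hdq.ne', mul_one, zero_mul] using this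
    have hzero' : ∀ p r, Tendsto (fun k => (M ^ k) p r) atTop (𝓝 0) := by
      intro p r
      obtain ⟨j, hj⟩ := hirr r q
      have h1 : Tendsto (fun k => (M ^ (k + j)) p q * ((M ^ j) r q)⁻¹) atTop (𝓝 0) := by
        simpa using ((tendsto_add_atTop_iff_nat j).2 (hzero p)).mul_const ((M ^ j) r q)⁻¹
      refine squeeze_zero (fun k => hpow k p r) (fun k => ?_) h1
      rw [← div_eq_mul_inv, le_div_iff₀ hj, pow_add, Matrix.mul_apply]
      exact Finset.single_le_sum (f := fun s => (M ^ k) p s * (M ^ j) s q)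
        (fun s _ => mul_nonneg (hpow k p s) (hpow j s q)) (Finset.mem_univ r)
    refine le_antisymm (fun p => ?_) hv
    have h2 : Tendsto (fun k => ((M ^ k) *ᵥ v) p) atTop (𝓝 (∑ r, 0 * v r)) :=
      tendsto_finsetSum _ fun r _ => (hzero' p r).mul_const (v r)
    simp only [zero_mul, Finset.sum_const_zero] at h2
    exact ge_of_tendsto' h2 fun k => hge k p

end Matrix

namespace NBA

variable {A Q : Type*}

/-! ### Runs, prefixes and König's lemma -/

section Runs

variable (U : NBA A Q)

lemma evalFrom_mono {S T : Set Q} (h : S ⊆ T) (x : List A) : U.evalFrom S x ⊆ U.evalFrom T x := by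
  intro q hq
  obtain ⟨t, ht, hqt⟩ := NFA.mem_evalFrom_iff_exists.1 hq
  exact NFA.mem_evalFrom_iff_exists.2 ⟨t, h ht, hqt⟩

@[simp] lemma evalFrom_empty (x : List A) : U.evalFrom ∅ x = ∅ := by
  ext q; rw [NFA.mem_evalFrom_iff_exists]; simp

lemma isAcceptingRun_consWord_iff {R : Set Q} {a : A} {w : ℕ → A} {ρ : ℕ → Q} :
    (U.withStart R).IsAcceptingRun (consWord a w) ρ ↔
      ρ 0 ∈ R ∧ ρ 1 ∈ U.step (ρ 0) a ∧
        (U.withStart {ρ 1}).IsAcceptingRun w (fun n => ρ (n + 1)) := by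
  have hinf : {i | ρ i ∈ U.accept}.Infinite ↔ {i | ρ (i + 1) ∈ U.accept}.Infinite := by
    simp only [← Nat.frequently_atTop_iff_infinite]
    exact (Filter.frequently_map (m := fun i => i + 1) (f := Filter.atTop)
      (P := fun i => ρ i ∈ U.accept)).symm.trans (by rw [Filter.map_add_atTop_eq_nat]) |>.symm
  simp only [IsAcceptingRun, IsRun, withStart, hinf, Set.mem_singleton_iff, true_and, zero_add]
  constructor
  · rintro ⟨⟨h0, h⟩, hi⟩
    exact ⟨h0, h 0, fun i => h (i + 1), hi⟩
  · rintro ⟨h0, h1, h, hi⟩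
    refine ⟨⟨h0, fun i => ?_⟩, hi⟩
    cases i with
    | zero => exact h1
    | succ i => exact h i

lemma mem_language_withStart {R : Set Q} {w : ℕ → A} :
    w ∈ (U.withStart R).language ↔ ∃ q ∈ R, w ∈ (U.withStart {q}).language := by
  simp only [language, IsAcceptingRun, IsRun, withStart, Set.mem_ofPred_eq, Set.mem_singleton_iff]
  constructor
  · rintro ⟨ρ, ⟨h0, h⟩, hi⟩
    exact ⟨ρ 0, h0, ρ, ⟨rfl, h⟩, hi⟩
  · rintro ⟨q, hq, ρ, ⟨rfl, h⟩, hi⟩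
    exact ⟨ρ, ⟨hq, h⟩, hi⟩

lemma language_withStart_mono {R S : Set Q} (h : R ⊆ S) :
    (U.withStart R).language ⊆ (U.withStart S).language := by
  intro w hw
  obtain ⟨q, hq, hw⟩ := U.mem_language_withStart.1 hw
  exact U.mem_language_withStart.2 ⟨q, h hq, hw⟩

@[simp] lemma language_withStart_empty : (U.withStart ∅).language = ∅ := by
  ext w; rw [mem_language_withStart]; simp

lemma consWord_mem_language_iff {R : Set Q} {a : A} {w : ℕ → A} :
    consWord a w ∈ (U.withStart R).language ↔
      w ∈ (U.withStart (U.stepSet R a)).language := by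
  rw [mem_language_withStart (R := U.stepSet R a)]
  constructor
  · rintro ⟨ρ, hρ⟩
    obtain ⟨h0, h1, h⟩ := U.isAcceptingRun_consWord_iff.1 hρ
    exact ⟨ρ 1, NFA.mem_stepSet.2 ⟨_, h0, h1⟩, _, h⟩
  · rintro ⟨q, hq, ρ, hρ⟩
    obtain ⟨p, hp, hq⟩ := NFA.mem_stepSet.1 hq
    have hρ0 : ρ 0 = q := hρ.1.1
    exact ⟨consWord p ρ, U.isAcceptingRun_consWord_iff.2
      ⟨hp, by simpa [← hρ0] using hq, by simpa [← hρ0] using hρ⟩⟩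

lemma appendWord_mem_language_iff {R : Set Q} {x : List A} {w : ℕ → A} :
    appendWord x w ∈ (U.withStart R).language ↔
      w ∈ (U.withStart (U.evalFrom R x)).language := by
  induction x generalizing R with
  | nil => rfl
  | cons a x ih => rw [appendWord_cons, consWord_mem_language_iff, ih, NFA.evalFrom_cons]

lemma exists_acceptingRun_appendWord {R : Set Q} {x : List A} {w : ℕ → A} {ρ : ℕ → Q}
    (hR : ρ 0 ∈ U.evalFrom R x) (hρ : (U.withStart {ρ 0}).IsAcceptingRun w ρ) :
    ∃ σ, (U.withStart R).IsAcceptingRun (appendWord x w) σ ∧ σ x.length = ρ 0 := by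
  induction x generalizing R with
  | nil => exact ⟨ρ, ⟨⟨hR, hρ.1.2⟩, hρ.2⟩, rfl⟩
  | cons a x ih =>
    obtain ⟨σ, hσ, hl⟩ := ih (R := U.stepSet R a) hR
    obtain ⟨p, hp, hq⟩ := NFA.mem_stepSet.1 hσ.1.1
    exact ⟨consWord p σ, U.isAcceptingRun_consWord_iff.2 ⟨hp, hq, ⟨rfl, hσ.1.2⟩, hσ.2⟩, hl⟩

/-- Words that have a run from `q` which avoids accepting states after its first state. -/
def avoiding (q : Q) : Set (ℕ → A) :=
  {w | ∃ ρ, (U.withStart {q}).IsRun w ρ ∧ ∀ i, ρ (i + 1) ∉ U.accept}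

lemma avoiding_subset (p : Q) :
    U.avoiding p ⊆ ⋃ a, ⋃ q ∈ U.step p a \ U.accept, consWord a '' U.avoiding q := by
  rintro w ⟨ρ, ⟨h0, h⟩, hav⟩
  obtain rfl : ρ 0 = p := h0
  simp only [Set.mem_iUnion]
  exact ⟨w 0, ρ 1, ⟨h 0, hav 0⟩, fun n => w (n + 1),
    ⟨fun n => ρ (n + 1), ⟨rfl, fun i => h (i + 1)⟩, fun i => hav (i + 1)⟩,
    consWord_head_tail w⟩

/-- The first `n` letters of an infinite word. -/
def _root_.takeWord (w : ℕ → A) (n : ℕ) : List A :=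
  List.ofFn fun i : Fin n => w i

lemma _root_.takeWord_succ (w : ℕ → A) (n : ℕ) :
    takeWord w (n + 1) = w 0 :: takeWord (fun i => w (i + 1)) n := by
  simp [takeWord, List.ofFn_succ]

lemma evalFrom_takeWord_eq_empty_of_le {R : Set Q} {w : ℕ → A} {m n : ℕ} (hmn : m ≤ n)
    (h : U.evalFrom R (takeWord w m) = ∅) : U.evalFrom R (takeWord w n) = ∅ := by
  obtain ⟨k, rfl⟩ := Nat.exists_eq_add_of_le hmn
  simp only [takeWord] at h ⊢
  rw [List.ofFn_add, NFA.evalFrom_append]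
  simp [h]

/-- Emptiness persists along prefixes, so if every state of `R` died, finiteness would give a common
time by which all are dead. -/
lemma exists_mem_forall_takeWord [Finite Q] {R : Set Q} {w : ℕ → A}
    (h : ∀ n, U.evalFrom R (takeWord w n) ≠ ∅) :
    ∃ q ∈ R, ∀ n, U.evalFrom {q} (takeWord w n) ≠ ∅ := by
  by_contra! hcon
  choose! k hk using hcon
  obtain ⟨K, hK⟩ := (Set.finite_range k).bddAbove
  refine h K (Set.eq_empty_iff_forall_notMem.2 fun r hr => ?_)
  obtain ⟨q, hq, hr⟩ := NFA.mem_evalFrom_iff_exists.1 hr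
  rw [U.evalFrom_takeWord_eq_empty_of_le (hK ⟨q, rfl⟩) (hk q hq)] at hr
  exact hr

/-- König's lemma for runs. -/
lemma exists_run [Finite Q] {R : Set Q} {w : ℕ → A}
    (h : ∀ n, U.evalFrom R (takeWord w n) ≠ ∅) : ∃ ρ, (U.withStart R).IsRun w ρ := by
  let live (n : ℕ) (q : Q) : Prop := ∀ k, U.evalFrom {q} (takeWord (fun i => w (i + n)) k) ≠ ∅
  have hnext : ∀ n q, live n q → ∃ q' ∈ U.step q (w n), live (n + 1) q' := by
    intro n q hq
    refine U.exists_mem_forall_takeWord fun k => ?_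
    have := hq (k + 1)
    rw [takeWord_succ, NFA.evalFrom_cons, NFA.stepSet_singleton] at this
    simpa only [zero_add, add_right_comm, add_assoc, add_comm 1] using this
  obtain ⟨q₀, hq₀, hlive⟩ := U.exists_mem_forall_takeWord h
  choose! next hstep hnext using hnext
  let ρ : ℕ → Q := fun n => Nat.rec q₀ (fun n q => next n q) n
  have hρ : ∀ n, live n (ρ n) := by
    intro n
    induction n with
    | zero => exact hlive
    | succ n ih => exact hnext n _ ih
  exact ⟨ρ, hq₀, fun n => hstep n _ (hρ n)⟩

end Runs

/-! ### Consequences of unambiguity and strong connectivity -/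

section Unambiguous

variable {U : NBA A Q}

/-- Accepting runs of w from r and s extend backwards to accepting runs of yxw from a start state,
where y leads to p. Unambiguity identifies them, yet they differ at position |yx|. -/
lemma disjoint_language_of_mem_evalFrom (hU : U.IsUnambiguous) (hsc : U.IsStronglyConnected)
    (hstart : U.start.Nonempty) {p r s : Q} {x : List A} (hr : r ∈ U.evalFrom {p} x)
    (hs : s ∈ U.evalFrom {p} x) (hrs : r ≠ s) :
    (U.withStart {r}).language ∩ (U.withStart {s}).language = ∅ := by
  refine Set.eq_empty_iff_forall_notMem.2 ?_
  rintro w ⟨⟨ρ, hρ⟩, σ, hσ⟩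
  obtain ⟨t, ht⟩ := hstart
  obtain ⟨y, hy⟩ := hsc t p
  obtain rfl : ρ 0 = r := hρ.1.1
  obtain rfl : σ 0 = s := hσ.1.1
  have key : ∀ {q}, q ∈ U.evalFrom {p} x → q ∈ U.evalFrom U.start (y ++ x) := by
    intro q hq
    rw [NFA.evalFrom_append]
    refine U.evalFrom_mono (Set.singleton_subset_iff.2 ?_) x hq
    exact U.evalFrom_mono (Set.singleton_subset_iff.2 ht) y hy
  obtain ⟨ρ', hρ', hl⟩ := U.exists_acceptingRun_appendWord (key hr) hρ
  obtain ⟨σ', hσ', hl'⟩ := U.exists_acceptingRun_appendWord (key hs) hσ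
  have : ρ' = σ' := hU _ _ _ hρ' hσ'
  exact hrs (by rw [← hl, ← hl', this])

/-- A strongly connected automaton with a transition accepts a word from each state. -/
lemma language_withStart_nonempty (hsc : U.IsStronglyConnected) (haccept : U.accept.Nonempty)
    {p₀ q₀ : Q} {a₀ : A} (h₀ : q₀ ∈ U.step p₀ a₀) (q : Q) :
    (U.withStart {q}).language.Nonempty := by
  classical
  obtain ⟨f, hf⟩ := haccept
  -- The word must be nonempty so that a run standing at f is still forced to move on and come back;
  -- the given transition makes this possible.
  have hreach : ∀ q, ∃ n, ∃ x : List A, x ≠ [] ∧ x.length = n ∧ f ∈ U.evalFrom {q} x := by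
    intro q
    obtain ⟨x, hx⟩ := hsc q p₀
    obtain ⟨y, hy⟩ := hsc q₀ f
    refine ⟨_, x ++ a₀ :: y, by simp, rfl, ?_⟩
    rw [NFA.evalFrom_append, NFA.evalFrom_cons]
    exact U.evalFrom_mono (Set.singleton_subset_iff.2 (NFA.mem_stepSet.2 ⟨p₀, hx, h₀⟩)) y hy
  let d : Q → ℕ := fun q => Nat.find (hreach q)
  have hstep : ∀ q, ∃ a, ∃ q' ∈ U.step q a, q' ∈ U.accept ∨ d q' < d q := by
    intro q
    obtain ⟨x, hne, hl, hx⟩ := Nat.find_spec (hreach q)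
    change x.length = d q at hl
    obtain ⟨a, x, rfl⟩ := List.exists_cons_of_ne_nil hne
    rw [NFA.evalFrom_cons, NFA.stepSet_singleton] at hx
    obtain ⟨q', hq', hx⟩ := NFA.mem_evalFrom_iff_exists.1 hx
    refine ⟨a, q', hq', ?_⟩
    by_cases hx0 : x = []
    · subst hx0
      rw [NFA.evalFrom_nil, Set.mem_singleton_iff] at hx
      exact Or.inl (hx ▸ hf)
    · have : d q' ≤ x.length := Nat.find_min' (hreach q') ⟨x, hx0, rfl, hx⟩
      simp only [List.length_cons] at hl
      exact Or.inr (by omega)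
  choose a next hnext hd using hstep
  let ρ : ℕ → Q := fun n => next^[n] q
  have hρ : ∀ n, ρ (n + 1) = next (ρ n) := fun n => Function.iterate_succ_apply' next n q
  have hfreq : ∀ k m, d (ρ m) ≤ k → ∃ n > m, ρ n ∈ U.accept := by
    intro k
    induction k with
    | zero =>
      intro m hm
      exact ⟨m + 1, m.lt_succ_self, hρ m ▸ (hd (ρ m)).resolve_right (by omega)⟩
    | succ k ih =>
      intro m hm
      rcases hd (ρ m) with h | h
      · exact ⟨m + 1, m.lt_succ_self, hρ m ▸ h⟩
      · obtain ⟨n, hn, hacc⟩ := ih (m + 1) (by rw [hρ]; omega)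
        exact ⟨n, by omega, hacc⟩
  refine ⟨fun n => a (ρ n), ρ, ⟨rfl, fun n => hρ n ▸ hnext (ρ n)⟩, ?_⟩
  rw [Set.infinite_iff_exists_gt]
  intro m
  obtain ⟨n, hn, hacc⟩ := hfreq _ m le_rfl
  exact ⟨n, hacc, hn⟩

end Unambiguous

/-! ### Counting paths by matrix powers -/

section TransitionMatrix

open Classical in
/-- The transition matrix of a single letter. -/
noncomputable def letterMatrix (U : NBA A Q) (a : A) : Matrix Q Q ℝ :=
  fun p q => if q ∈ U.step p a then 1 else 0

/-- The sum of the transition matrices of all letters. -/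
noncomputable def transitionMatrix [Fintype A] (U : NBA A Q) : Matrix Q Q ℝ :=
  ∑ a, U.letterMatrix a

variable {U : NBA A Q}

lemma letterMatrix_nonneg (a : A) (p q : Q) : 0 ≤ U.letterMatrix a p q := by
  unfold letterMatrix; split_ifs <;> norm_num

lemma transitionMatrix_apply [Fintype A] (p q : Q) :
    U.transitionMatrix p q = ∑ a, U.letterMatrix a p q := by
  rw [transitionMatrix, Matrix.sum_apply]

lemma transitionMatrix_nonneg [Fintype A] (p q : Q) : 0 ≤ U.transitionMatrix p q := by
  rw [transitionMatrix_apply]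
  exact Finset.sum_nonneg fun a _ => letterMatrix_nonneg a p q

lemma letterMatrix_le_transitionMatrix [Fintype A] (a : A) (p q : Q) :
    U.letterMatrix a p q ≤ U.transitionMatrix p q := by
  rw [transitionMatrix_apply]
  exact Finset.single_le_sum (f := fun a => U.letterMatrix a p q)
    (fun a _ => letterMatrix_nonneg a p q) (Finset.mem_univ a)

variable [Fintype Q] [DecidableEq Q]

open Classical in
/-- In an unambiguous automaton a finite word labels at most one path between two states. -/
lemma prod_letterMatrix_apply (hU : U.IsUnambiguous) (hsc : U.IsStronglyConnected)
    (hstart : U.start.Nonempty) (haccept : U.accept.Nonempty) (x : List A) (p q : Q) :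
    (x.map U.letterMatrix).prod p q = if q ∈ U.evalFrom {p} x then 1 else 0 := by
  induction x using List.reverseRecOn generalizing q with
  | nil => simp [Matrix.one_apply, eq_comm]
  | append_singleton x a ih =>
    rw [List.map_append, List.prod_append, Matrix.mul_apply, NFA.evalFrom_append,
      NFA.evalFrom_singleton]
    simp only [List.map_cons, List.map_nil, List.prod_singleton, ih]
    by_cases h : q ∈ U.stepSet (U.evalFrom {p} x) a
    · rw [if_pos h]
      obtain ⟨r, hr, hq⟩ := NFA.mem_stepSet.1 h
      rw [Finset.sum_eq_single r]
      · simp [hr, letterMatrix, hq]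
      -- Two distinct predecessors of q in δ(p, x) would both accept aw for any w accepted from q.
      · intro s _ hsr
        by_contra hne
        rw [letterMatrix, ite_zero_mul_ite_zero, ite_eq_right_iff, Classical.not_imp] at hne
        obtain ⟨⟨hs, hq'⟩, -⟩ := hne
        obtain ⟨w, hw⟩ := language_withStart_nonempty hsc haccept hq q
        have key : ∀ {t}, q ∈ U.step t a → consWord a w ∈ (U.withStart {t}).language := by
          intro t ht
          rw [consWord_mem_language_iff, NFA.stepSet_singleton]
          exact U.language_withStart_mono (Set.singleton_subset_iff.2 ht) hw
        exact (disjoint_language_of_mem_evalFrom hU hsc hstart hs hr hsr).le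
          ⟨key hq', key hq⟩
      · simp
    · rw [if_neg h]
      refine Finset.sum_eq_zero fun r _ => ?_
      rw [letterMatrix, ite_zero_mul_ite_zero, if_neg]
      exact fun hr => h (NFA.mem_stepSet.2 ⟨r, hr⟩)

/-- The power is a sum of |Σ|^n word matrices, each with entries 0 or 1. The induction carries a
word read so far. -/
lemma transitionMatrix_pow_le [Fintype A] (hU : U.IsUnambiguous) (hsc : U.IsStronglyConnected)
    (hstart : U.start.Nonempty) (haccept : U.accept.Nonempty) (n : ℕ) (p q : Q) :
    (U.transitionMatrix ^ n) p q ≤ (Fintype.card A : ℝ) ^ n := by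
  have key : ∀ (n : ℕ) (x : List A),
      ((x.map U.letterMatrix).prod * U.transitionMatrix ^ n) p q ≤ (Fintype.card A : ℝ) ^ n := by
    intro n
    induction n with
    | zero =>
      intro x
      rw [pow_zero, mul_one, pow_zero, prod_letterMatrix_apply hU hsc hstart haccept]
      split_ifs <;> norm_num
    | succ n ih =>
      intro x
      have : (x.map U.letterMatrix).prod * U.transitionMatrix ^ (n + 1) =
          ∑ a, ((x ++ [a]).map U.letterMatrix).prod * U.transitionMatrix ^ n := by
        simp only [List.map_append, List.prod_append, List.map_cons, List.map_nil,
          List.prod_singleton]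
        rw [← Finset.sum_mul, ← Finset.mul_sum, pow_succ', ← mul_assoc, ← transitionMatrix]
      rw [this, Matrix.sum_apply]
      refine (Finset.sum_le_sum fun a _ => ih (x ++ [a])).trans_eq ?_
      rw [Finset.sum_const, Finset.card_univ, nsmul_eq_mul, pow_succ']
  simpa using key n []

lemma transitionMatrix_pow_pos [Fintype A] {p q : Q} {x : List A} (h : q ∈ U.evalFrom {p} x) :
    0 < (U.transitionMatrix ^ x.length) p q := by
  induction x generalizing p with
  | nil =>
    obtain rfl : q = p := h
    simp
  | cons a x ih =>
    rw [NFA.evalFrom_cons, NFA.stepSet_singleton] at h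
    obtain ⟨r, hr, hq⟩ := NFA.mem_evalFrom_iff_exists.1 h
    rw [List.length_cons, pow_succ', Matrix.mul_apply]
    refine Finset.sum_pos' (fun s _ => mul_nonneg (transitionMatrix_nonneg p s)
      (Matrix.pow_entry_nonneg transitionMatrix_nonneg _ s q)) ⟨r, Finset.mem_univ r, ?_⟩
    refine mul_pos (lt_of_lt_of_le ?_ (letterMatrix_le_transitionMatrix a p r)) (ih hq)
    simp [letterMatrix, hr]

end TransitionMatrix

end NBA

namespace NBA

/-! ### Probabilities of languages, and cuts -/

section Probability

variable {A Q : Type*} [Fintype A] [Nonempty A] [MeasurableSpace A] [DiscreteMeasurableSpace A]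
  {U : NBA A Q}

/-- Almost no word has a run that avoids accepting states. -/
lemma uniformWordMeasure_avoiding [Finite Q] (hU : U.IsUnambiguous) (hsc : U.IsStronglyConnected)
    (hstart : U.start.Nonempty) (haccept : U.accept.Nonempty)
    {p₀ q₀ : Q} {a₀ : A} (h₀ : q₀ ∈ U.step p₀ a₀) (q : Q) :
    uniformWordMeasure A (U.avoiding q) = 0 := by
  classical
  have := Fintype.ofFinite Q
  have hcard : (0 : ℝ) < Fintype.card A := by exact_mod_cast Fintype.card_pos
  -- A transition into F supplies the entry at which `M'` is strictly below `M`.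
  obtain ⟨p₁, f, a₁, hf, hpf⟩ : ∃ p f a, f ∈ U.accept ∧ f ∈ U.step p a := by
    obtain ⟨f, hf⟩ := haccept
    obtain ⟨y, hy⟩ := hsc q₀ f
    rcases List.eq_nil_or_concat y with rfl | ⟨y, a, rfl⟩
    · obtain rfl : f = q₀ := hy
      exact ⟨p₀, f, a₀, hf, h₀⟩
    · rw [List.concat_eq_append, NFA.evalFrom_append, NFA.evalFrom_singleton] at hy
      obtain ⟨p, -, hp⟩ := NFA.mem_stepSet.1 hy
      exact ⟨p, f, a, hf, hp⟩
  let c : ℝ := (Fintype.card A : ℝ)⁻¹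
  have hc : 0 < c := inv_pos.2 hcard
  let M : Matrix Q Q ℝ := c • U.transitionMatrix
  let M' : Matrix Q Q ℝ := fun p q => if q ∈ U.accept then 0 else M p q
  let v : Q → ℝ := fun q => (uniformWordMeasure A).real (U.avoiding q)
  have hM : ∀ p q, 0 ≤ M p q := fun p q => mul_nonneg hc.le (transitionMatrix_nonneg p q)
  have hpow : ∀ n p q, (M ^ n) p q = c ^ n * (U.transitionMatrix ^ n) p q := fun n p q => by
    simp only [M, smul_pow, Matrix.smul_apply, smul_eq_mul]
  have hv : v = 0 := by
    refine Matrix.eq_zero_of_le_mulVec (M := M) (M' := M') (K := 1) (p₀ := p₁) (q₀ := f)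
      hM ?_ ?_ ?_ ?_ (fun q => measureReal_nonneg) ?_
    · intro n p q
      rw [hpow, inv_pow, inv_mul_le_iff₀ (pow_pos hcard n), mul_one]
      exact transitionMatrix_pow_le hU hsc hstart haccept n p q
    · intro p q
      obtain ⟨x, hx⟩ := hsc p q
      exact ⟨x.length, by rw [hpow]; exact mul_pos (pow_pos hc _) (transitionMatrix_pow_pos hx)⟩
    · intro p q
      simp only [M']
      split_ifs
      exacts [hM p q, le_rfl]
    · simp only [M', if_pos hf]
      have h1 := letterMatrix_le_transitionMatrix (U := U) a₁ p₁ f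
      simp only [letterMatrix, if_pos hpf] at h1
      exact mul_pos hc (by linarith)
    · intro p
      have himg : ∀ a q, (uniformWordMeasure A).real (consWord a '' U.avoiding q) = c * v q := by
        intro a q
        simp [v, c, Measure.real, uniformWordMeasure_image_consWord]
      calc v p ≤ (uniformWordMeasure A).real
            (⋃ a, ⋃ q, if q ∈ U.step p a \ U.accept then consWord a '' U.avoiding q else ∅) := by
            refine measureReal_mono ((U.avoiding_subset p).trans ?_)
            refine Set.iUnion_mono fun a => Set.iUnion_mono fun q => ?_
            exact Set.iUnion_subset fun h => by rw [if_pos h]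
        _ ≤ ∑ a, ∑ q, (uniformWordMeasure A).real
            (if q ∈ U.step p a \ U.accept then consWord a '' U.avoiding q else ∅) :=
            (measureReal_iUnion_fintype_le _).trans
              (Finset.sum_le_sum fun a _ => measureReal_iUnion_fintype_le _)
        _ = ∑ q, ∑ a, (if q ∈ U.accept then 0 else c * U.letterMatrix a p q) * v q := by
            rw [Finset.sum_comm]
            refine Finset.sum_congr rfl fun q _ => Finset.sum_congr rfl fun a _ => ?_
            by_cases h1 : q ∈ U.accept
            · simp [h1]
            · by_cases h2 : q ∈ U.step p a
              · simp [h1, h2, himg, letterMatrix]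
              · simp [h1, h2, letterMatrix]
        _ = (M'.mulVec v) p := by
            refine Finset.sum_congr rfl fun q _ => ?_
            rw [← Finset.sum_mul]
            congr 1
            simp only [M', M]
            split_ifs
            · simp
            · rw [Matrix.smul_apply, transitionMatrix_apply, smul_eq_mul, Finset.mul_sum]
  have := congrFun hv q
  exact (measureReal_eq_zero_iff).1 this

/-- If `R` survives every word, then almost every word is accepted from `R`. -/
lemma uniformWordMeasure_compl_language [Finite Q] (hU : U.IsUnambiguous)
    (hsc : U.IsStronglyConnected) (hstart : U.start.Nonempty) (haccept : U.accept.Nonempty)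
    {R : Set Q} (hR : ∀ y : List A, U.evalFrom R y ≠ ∅) :
    uniformWordMeasure A (U.withStart R).languageᶜ = 0 := by
  obtain ⟨p₀, q₀, a₀, h₀⟩ : ∃ p q, ∃ a, q ∈ U.step p a := by
    obtain ⟨a⟩ := ‹Nonempty A›
    obtain ⟨q, hq⟩ := Set.nonempty_iff_ne_empty.2 (hR [a])
    obtain ⟨p, -, hp⟩ := NFA.mem_stepSet.1 hq
    exact ⟨p, q, a, hp⟩
  have hnull : uniformWordMeasure A
      (⋃ m : ℕ, ⋃ q : Q, (fun w : ℕ → A => fun n => w (n + m)) ⁻¹' U.avoiding q) = 0 := by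
    refine measure_iUnion_null fun m => measure_iUnion_null fun q => ?_
    exact (measurePreserving_drop m).quasiMeasurePreserving.preimage_null
      (uniformWordMeasure_avoiding hU hsc hstart haccept h₀ q)
  refine measure_mono_null (fun w hw => ?_) hnull
  obtain ⟨ρ, hρ⟩ := U.exists_run (w := w) fun n => hR (takeWord w n)
  -- After its last visit to F, the run witnesses that a suffix of w lies in an avoiding set.
  have hfin : ¬ {i | ρ i ∈ U.accept}.Infinite := fun h => hw ⟨ρ, hρ, h⟩
  rw [Set.not_infinite] at hfin
  obtain ⟨m, hm⟩ := hfin.bddAbove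
  simp only [Set.mem_iUnion, Set.mem_preimage]
  refine ⟨m, ρ m, fun n => ρ (n + m), ⟨by simp [withStart], fun i => ?_⟩, fun i hi => ?_⟩
  · have := hρ.2 (i + m)
    rwa [add_right_comm] at this
  · have : i + 1 + m ≤ m := hm hi
    omega

lemma inv_card_mul_le_uniformWordMeasure_language (R : Set Q) (a : A) :
    (Fintype.card A : ENNReal)⁻¹ * uniformWordMeasure A (U.withStart (U.stepSet R a)).language ≤
      uniformWordMeasure A (U.withStart R).language := by
  rw [← uniformWordMeasure_image_consWord a]
  refine measure_mono ?_
  rintro _ ⟨w, hw, rfl⟩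
  exact U.consWord_mem_language_iff.2 hw

lemma uniformWordMeasure_language_pos_of_evalFrom {R : Set Q} {x : List A}
    (h : 0 < uniformWordMeasure A (U.withStart (U.evalFrom R x)).language) :
    0 < uniformWordMeasure A (U.withStart R).language := by
  induction x generalizing R with
  | nil => exact h
  | cons a x ih =>
    refine lt_of_lt_of_le ?_ (inv_card_mul_le_uniformWordMeasure_language R a)
    exact ENNReal.mul_pos (ENNReal.inv_ne_zero.2 (ENNReal.natCast_ne_top _)) (ih h).ne'

/-- In a positive strongly connected automaton each state has a language of positive measure. -/
lemma IsPositive.uniformWordMeasure_language_pos [Finite Q] (hpos : U.IsPositive)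
    (hsc : U.IsStronglyConnected) (q : Q) :
    0 < uniformWordMeasure A (U.withStart {q}).language := by
  obtain ⟨s, hs⟩ : ∃ s, 0 < uniformWordMeasure A (U.withStart {s}).language := by
    by_contra! hcon
    refine hpos.ne' (measure_mono_null (t := ⋃ s, (U.withStart {s}).language) ?_
      (measure_iUnion_null fun s => nonpos_iff_eq_zero.1 (hcon s)))
    intro w hw
    obtain ⟨s, -, hs⟩ := U.mem_language_withStart (R := U.start) |>.1 hw
    exact Set.mem_iUnion.2 ⟨s, hs⟩
  obtain ⟨x, hx⟩ := hsc q s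
  exact uniformWordMeasure_language_pos_of_evalFrom (x := x) (lt_of_lt_of_le hs
    (measure_mono (U.language_withStart_mono (Set.singleton_subset_iff.2 hx))))

lemma uniformWordMeasure_language_le_sum (R : Set Q) :
    uniformWordMeasure A (U.withStart R).language ≤ ∑ a, (Fintype.card A : ENNReal)⁻¹ *
      uniformWordMeasure A (U.withStart (U.stepSet R a)).language := by
  have himg (a : A) := uniformWordMeasure_image_consWord a (U.withStart (U.stepSet R a)).language
  simp_rw [← himg]
  refine (measure_mono fun w hw => ?_).trans (measure_iUnion_fintype_le _ _)
  rw [← consWord_head_tail w, consWord_mem_language_iff] at hw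
  exact Set.mem_iUnion.2 ⟨w 0, _, hw, consWord_head_tail w⟩

/-- A state whose language has positive measure can be led to a set that survives every word. -/
lemma exists_forall_evalFrom_ne_empty [Finite Q] {q : Q}
    (hq : 0 < uniformWordMeasure A (U.withStart {q}).language) :
    ∃ x : List A, ∀ y : List A, U.evalFrom {q} (x ++ y) ≠ ∅ := by
  let μ : Set Q → ENNReal := fun R => uniformWordMeasure A (U.withStart R).language
  -- Only finitely many sets are reachable. At one of maximal measure, that measure is at most the
  -- average over its successors, so all of them are maximal too; hence the empty set is never
  -- reached.
  obtain ⟨_, ⟨x, rfl⟩, hmax⟩ := Set.exists_max_image (Set.range (U.evalFrom {q})) μ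
    (Set.toFinite _) ⟨_, [], rfl⟩
  refine ⟨x, ?_⟩
  have hx : 0 < μ (U.evalFrom {q} x) := hq.trans_le (hmax _ ⟨[], rfl⟩)
  have hmax' : ∀ y, μ (U.evalFrom {q} y) ≤ μ (U.evalFrom {q} x) := fun y => hmax _ ⟨y, rfl⟩
  have hc0 : (Fintype.card A : ENNReal)⁻¹ ≠ 0 := ENNReal.inv_ne_zero.2 (ENNReal.natCast_ne_top _)
  have hct : (Fintype.card A : ENNReal)⁻¹ ≠ ⊤ :=
    ENNReal.inv_ne_top.2 (by exact_mod_cast Fintype.card_ne_zero)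
  have hstep : ∀ y, μ (U.evalFrom {q} y) = μ (U.evalFrom {q} x) →
      ∀ a, μ (U.evalFrom {q} (y ++ [a])) = μ (U.evalFrom {q} x) := by
    intro y hy a
    refine le_antisymm (hmax' _) (le_of_not_gt fun hlt => ?_)
    have h1 := uniformWordMeasure_language_le_sum (U := U) (U.evalFrom {q} y)
    have h2 : ∑ b, (Fintype.card A : ENNReal)⁻¹ * μ (U.evalFrom {q} (y ++ [b])) <
        ∑ b : A, (Fintype.card A : ENNReal)⁻¹ * μ (U.evalFrom {q} x) := by
      classical
      rw [← Finset.add_sum_erase _ _ (Finset.mem_univ a),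
        ← Finset.add_sum_erase (f := fun _ => _ * _) _ (Finset.mem_univ a)]
      refine ENNReal.add_lt_add_of_lt_of_le ?_ (ENNReal.mul_lt_mul_right hc0 hct hlt)
        (Finset.sum_le_sum fun b _ => mul_le_mul_right (hmax' _) _)
      exact ENNReal.sum_ne_top.2 fun b _ => ENNReal.mul_ne_top hct (measure_ne_top _ _)
    have h3 : ∑ b : A, (Fintype.card A : ENNReal)⁻¹ * μ (U.evalFrom {q} x) =
        μ (U.evalFrom {q} x) := by
      rw [Finset.sum_const, Finset.card_univ, nsmul_eq_mul, ← mul_assoc,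
        ENNReal.mul_inv_cancel (by exact_mod_cast Fintype.card_ne_zero)
          (ENNReal.natCast_ne_top _), one_mul]
    rw [h3, ← hy] at h2
    simp only [NFA.evalFrom_append, NFA.evalFrom_singleton] at h2
    exact absurd h1 (not_le.2 h2)
  have hall : ∀ y, μ (U.evalFrom {q} (x ++ y)) = μ (U.evalFrom {q} x) := by
    intro y
    induction y using List.reverseRecOn with
    | nil => rw [List.append_nil]
    | append_singleton y a ih => rw [← List.append_assoc]; exact hstep _ ih a
  intro y hy
  have := hall y
  rw [hy] at this
  simp only [μ, language_withStart_empty, measure_empty] at this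
  exact hx.ne this

/-- A set of states reached from one state is a cut if it survives every word. -/
lemma isCut_evalFrom [Finite Q] (hU : U.IsUnambiguous) (hsc : U.IsStronglyConnected)
    (hstart : U.start.Nonempty) (haccept : U.accept.Nonempty) {q : Q} {z : List A}
    (h : ∀ y : List A, U.evalFrom (U.evalFrom {q} z) y ≠ ∅) : U.IsCut (U.evalFrom {q} z) := by
  refine ⟨fun p hp r hr hpr => disjoint_language_of_mem_evalFrom hU hsc hstart hr hp hpr.symm, ?_⟩
  have hae : (U.withStart (U.evalFrom {q} z)).language =ᵐ[uniformWordMeasure A] Set.univ :=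
    ae_eq_univ.2 (uniformWordMeasure_compl_language hU hsc hstart haccept h)
  rw [IsAlmostUniversal, measure_congr hae, measure_univ]

lemma measurableSet_cylinder_and_pos (x : List A) :
    MeasurableSet (appendWord x '' Set.univ) ∧
      0 < uniformWordMeasure A (appendWord x '' Set.univ) := by
  induction x with
  | nil =>
    have : appendWord ([] : List A) = id := rfl
    simp [this]
  | cons a x ih =>
    have himg : appendWord (a :: x) '' Set.univ = consWord a '' (appendWord x '' Set.univ) := by
      rw [Set.image_image]; rfl
    have himg' : consWord a '' (appendWord x '' Set.univ) =
        consWordEquiv A '' ({a} ×ˢ (appendWord x '' Set.univ)) := by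
      simp [Set.singleton_prod, Set.image_image]
    rw [himg]
    refine ⟨?_, ?_⟩
    · rw [himg']
      exact (consWordEquiv A).measurableSet_image.2 ((measurableSet_singleton a).prod ih.1)
    · rw [uniformWordMeasure_image_consWord]
      exact ENNReal.mul_pos (ENNReal.inv_ne_zero.2 (ENNReal.natCast_ne_top _)) ih.2.ne'

/-- A cut survives every word. -/
lemma IsCut.evalFrom_ne_empty {C : Set Q} (hC : U.IsCut C) (y : List A) :
    U.evalFrom C y ≠ ∅ := by
  intro hy
  obtain ⟨hmeas, hpos⟩ := measurableSet_cylinder_and_pos y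
  have hsub : (U.withStart C).language ⊆ (appendWord y '' Set.univ)ᶜ := by
    rintro _ hw ⟨w, -, rfl⟩
    rw [appendWord_mem_language_iff, hy, language_withStart_empty] at hw
    exact hw
  have h1 : uniformWordMeasure A (appendWord y '' Set.univ)ᶜ = 1 :=
    le_antisymm prob_le_one (hC.2.symm.le.trans (measure_mono hsub))
  rw [prob_compl_eq_one_iff hmeas] at h1
  exact hpos.ne' h1

/-- In a positive automaton a cut cannot be enlarged by states with a disjoint language. -/
lemma IsCut.mem_of_disjoint [Finite Q] (hU : U.IsUnambiguous) (hsc : U.IsStronglyConnected)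
    (hstart : U.start.Nonempty) (haccept : U.accept.Nonempty) (hpos : U.IsPositive)
    {C : Set Q} (hC : U.IsCut C) {r : Q}
    (hr : ∀ p ∈ C, r ≠ p → Disjoint (U.withStart {r}).language (U.withStart {p}).language) :
    r ∈ C := by
  by_contra hrC
  -- The language of r would lie in the null complement of the language of C, though positivity
  -- gives it positive measure.
  refine (hpos.uniformWordMeasure_language_pos hsc r).ne' (measure_mono_null ?_
    (uniformWordMeasure_compl_language hU hsc hstart haccept hC.evalFrom_ne_empty))
  intro w hw hwC
  obtain ⟨p, hp, hwp⟩ := U.mem_language_withStart.1 hwC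
  exact Set.disjoint_left.1 (hr p hp fun h => hrC (h ▸ hp)) hw hwp

end Probability

end NBA

/-! ### The characterisations of pure cuts -/

theorem mainTheorem6 {A Q : Type*} [Fintype A] [Nontrivial A]
    [MeasurableSpace A] [DiscreteMeasurableSpace A] [Finite Q]
    (U : NBA A Q) (hU : U.IsUnambiguous) (hsc : U.IsStronglyConnected)
    (hstart : U.start.Nonempty) (haccept : U.accept.Nonempty) :
    (∀ (q : Q) (z : List A),
      U.IsCut (U.evalFrom {q} z) ↔ ∀ y : List A, U.evalFrom {q} (z ++ y) ≠ ∅) ∧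
    (U.IsPositive → ∀ C : Set Q, U.IsCut C →
      (U.IsPureCut C ↔ ∀ q : Q, ∃ z : List A, C = U.evalFrom {q} z) ∧
      ((∀ q : Q, ∃ z : List A, C = U.evalFrom {q} z) ↔
        ∀ C' : Set Q, U.IsCut C' → ∃ y : List A, C = U.evalFrom C' y)) := by
  have hsurv : ∀ {q : Q} {z : List A}, (∀ y : List A, U.evalFrom {q} (z ++ y) ≠ ∅) →
      U.IsCut (U.evalFrom {q} z) := fun h =>
    NBA.isCut_evalFrom hU hsc hstart haccept fun y => by rw [← NFA.evalFrom_append]; exact h y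
  have hcut : ∀ {q : Q} {z : List A}, U.IsCut (U.evalFrom {q} z) →
      ∀ y : List A, U.evalFrom {q} (z ++ y) ≠ ∅ := fun h y => by
    rw [NFA.evalFrom_append]; exact h.evalFrom_ne_empty y
  refine ⟨fun q z => ⟨hcut, hsurv⟩, fun hpos C hC => ⟨⟨?_, ?_⟩, ?_, ?_⟩⟩
  · rintro ⟨-, q, z, rfl⟩ p
    obtain ⟨x, hx⟩ := NBA.exists_forall_evalFrom_ne_empty
      (hpos.uniformWordMeasure_language_pos hsc p)
    obtain ⟨r, hr⟩ := Set.nonempty_iff_ne_empty.2 (hx [])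
    rw [List.append_nil] at hr
    obtain ⟨u, hu⟩ := hsc r q
    -- The path from p through r to q gives a set containing C; its states have pairwise disjoint
    -- languages, so maximality of C forces equality.
    refine ⟨x ++ u ++ z, ?_⟩
    have hsub : U.evalFrom {q} z ⊆ U.evalFrom {p} (x ++ u ++ z) := by
      rw [NFA.evalFrom_append, NFA.evalFrom_append]
      refine U.evalFrom_mono (Set.singleton_subset_iff.2 ?_) z
      exact U.evalFrom_mono (Set.singleton_subset_iff.2 hr) u hu
    refine hsub.antisymm fun s hs => ?_
    refine hC.mem_of_disjoint hU hsc hstart haccept hpos fun t ht hst => ?_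
    exact Set.disjoint_iff_inter_eq_empty.2
      (NBA.disjoint_language_of_mem_evalFrom hU hsc hstart hs (hsub ht) hst)
  · intro h
    obtain ⟨q, -⟩ := hstart
    exact ⟨hC, q, h q⟩
  · intro h C' hC'
    obtain ⟨q, hq⟩ : C'.Nonempty := Set.nonempty_iff_ne_empty.2 (hC'.evalFrom_ne_empty [])
    obtain ⟨z, rfl⟩ := h q
    have hsub : U.evalFrom {q} z ⊆ U.evalFrom C' z :=
      U.evalFrom_mono (Set.singleton_subset_iff.2 hq) z
    refine ⟨z, hsub.antisymm fun r hr => ?_⟩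
    obtain ⟨q', hq', hr⟩ := NFA.mem_evalFrom_iff_exists.1 hr
    by_cases hqq : q' = q
    · exact hqq ▸ hr
    -- A word w accepted from both r and t would put zw in the languages of both q' and q, which are
    -- disjoint because C' is a cut.
    refine hC.mem_of_disjoint hU hsc hstart haccept hpos fun t ht _ => ?_
    have key : ∀ {p s : Q}, s ∈ U.evalFrom {p} z → ∀ {w : ℕ → A},
        w ∈ (U.withStart {s}).language → appendWord z w ∈ (U.withStart {p}).language :=
      fun hs _ hw => U.appendWord_mem_language_iff.2
        (U.language_withStart_mono (Set.singleton_subset_iff.2 hs) hw)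
    refine Set.disjoint_left.2 fun w hw hw' => ?_
    exact (hC'.1 q' hq' q hq hqq).le ⟨key ht hw', key hr hw⟩
  · intro h q
    obtain ⟨x, hx⟩ := NBA.exists_forall_evalFrom_ne_empty
      (hpos.uniformWordMeasure_language_pos hsc q)
    -- δ(q, x) survives every word, so it is itself a cut to which the hypothesis applies.
    obtain ⟨y, hy⟩ := h _ (hsurv hx)
    exact ⟨x ++ y, by rw [hy, NFA.evalFrom_append]⟩
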